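/- Let $K/F$ be a finite cyclic Galois extension of fields of degree $n$ whose Galois group is generated by $\sigma$, and let $R=K[t;\sigma]$ be the twisted polynomial ring, in which $ta=\sigma(a)t$ for $a\in K$. For nonzero $f\in R$ of degree $m$, let $S_f=R/Rf$ be the Petit algebra: the set of all $g\in R$ with $\deg g<m$, with the usual addition and the multiplication $g\circ h=gh \bmod_r f$, the remainder of the right division of $gh$ by $f$ (so $gh=qf+r$ with $\deg r<m$). It is a left $K$-vector space of dimension $m$, and for each $a\in S_f$ the right multiplication $R_a(x)=x\circ a$ is $K$-linear; a choice of a $K$-basis of $S_f$ thus identifies $\{R_a : a\in S_f\}$ with a subset of $M_m(K)$. A bound $f^*$ of $f$ is a nonzero element of $R$ such that $Rf^*$ is the largest two-sided ideal of $R$ contained in $Rf$; it is unique up to a factor in $K^\times$. Let $I(F,m_0)$ be the set of monic irreducible polynomials of degree $m_0$ in $F[x]$, and let $$G=N_{K/F}(K^\times)\rtimes\{\tau\in\operatorname{Aut}(K) : \sigma\tau=\tau\sigma,\ \tau(F)=F\}$$ act on $I(F,m_0)$ by $h^{(\lambda,\tau)}(x)=\lambda^{-m_0}h^{\tau}(\lambda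 x)$, where $h^\tau$ is obtained from $h$ by applying $\tau$ to the coefficients. Call two subsets $C,C'$ of $M_m(K)$ equivalent if $C'=XC^{\varphi}Y$ for some ring automorphism $\varphi$ of $M_m(K)$ and some invertible $X,Y\in M_m(K)$. An $F$-subspace $C$ of $M_m(K)$ with minimum rank distance $d$ is an ($F$-linear) MRD code if $\dim_F C=n\,m(m-d+1)$. **Theorem.** Let $\hat h_1,\hat h_2\in I(F,m_0)$ lie in the same $G$-orbit, and let $f,g\in R$ be monic irreducible of degree $m$ with bounds $f^*=\hat h_1(t^n)$ and $g^*=\hat h_2(t^n)$. Then, for every choice of $K$-bases of $S_f$ and $S_g$, the codes $C=\{R_a : a\in S_f\}$ and $C'=\{R_a : a\in S_g\}$ in $M_m(K)$ are $F$-linear MRD codes, and they are equivalent. -/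

import Mathlib

noncomputable section

open Polynomial

namespace PetitCode

variable {F K : Type*} [Field F] [Field K] [Algebra F K]

/-! ### The twisted polynomial ring `K[t;σ]` -/

/-- The action of `ℕ` on `K` through the powers of `σ`. -/
@[reducible] def twistAction (σ : K ≃ₐ[F] K) : MulSemiringAction (Multiplicative ℕ) K :=
  MulSemiringAction.compHom K (powersHom (K ≃ₐ[F] K) σ)

/-- The twisted polynomial ring `R = K[t;σ]`, in which `t a = σ(a) t`: Mathlib's skew polynomials
over `K` for the endomorphism `σ`. -/
def TwistedPoly (_σ : K ≃ₐ[F] K) : Type _ := SkewPolynomial K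

instance (σ : K ≃ₐ[F] K) : Ring (TwistedPoly σ) :=
  letI := twistAction σ
  inferInstanceAs (Ring (SkewPolynomial K))

namespace TwistedPoly

variable {σ : K ≃ₐ[F] K}

/-- The coefficient of `t ^ i`, coefficients being written on the left. -/
def coeff (p : TwistedPoly σ) (i : ℕ) : K := SkewPolynomial.coeff (R := K) p i

variable (σ) in
/-- The constant polynomials. -/
def const : K →+* TwistedPoly σ :=
  letI := twistAction σ
  SkewPolynomial.CRingHom (R := K)

variable (σ) in
/-- The variable `t`. -/
def t : TwistedPoly σ := SkewPolynomial.X (R := K)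

/-- `K` acts on `R` by multiplication by constants from the left. -/
instance : Module K (TwistedPoly σ) := Module.compHom (TwistedPoly σ) (const σ)

theorem smul_eq (c : K) (p : TwistedPoly σ) : c • p = const σ c * p := rfl

theorem t_mul_const (a : K) : t σ * const σ a = const σ (σ a) * t σ := by
  let := twistAction σ
  have h := SkewPolynomial.X_mul_monomial (R := K) 0 a
  have h2 := SkewPolynomial.monomial_mul_X (R := K) 0 (σ a)
  exact h.trans h2.symm

@[ext] theorem ext {p q : TwistedPoly σ} (h : ∀ i, p.coeff i = q.coeff i) : p = q :=
  SkewMonoidAlgebra.ext (k := K) (G := Multiplicative ℕ) h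

@[simp] theorem coeff_zero (i : ℕ) : (0 : TwistedPoly σ).coeff i = 0 := rfl

@[simp] theorem coeff_add (p q : TwistedPoly σ) (i : ℕ) :
    (p + q).coeff i = p.coeff i + q.coeff i := by
  let := twistAction σ
  have h := SkewMonoidAlgebra.coeff_add (k := K) (G := Multiplicative ℕ) p q
  exact DFunLike.congr_fun h (Multiplicative.ofAdd i)

theorem coeff_mul (p q : TwistedPoly σ) (i : ℕ) :
    (p * q).coeff i
      = ∑ x ∈ Finset.HasAntidiagonal.antidiagonal i, p.coeff x.1 * (σ ^ x.1) (q.coeff x.2) := by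
  let := twistAction σ
  exact SkewMonoidAlgebra.coeff_mul_antidiagonal_of_finset (k := K) (G := Multiplicative ℕ) p q
    (Multiplicative.ofAdd i) (Finset.HasAntidiagonal.antidiagonal (A := ℕ) i)
    (fun {x} => Finset.HasAntidiagonal.mem_antidiagonal (A := ℕ) (n := i) (a := x))

@[simp] theorem coeff_const_mul (c : K) (p : TwistedPoly σ) (i : ℕ) :
    (const σ c * p).coeff i = c * p.coeff i := by
  let := twistAction σ
  exact SkewMonoidAlgebra.coeff_single_one_mul (k := K) (G := Multiplicative ℕ) p c _

@[simp] theorem coeff_smul (c : K) (p : TwistedPoly σ) (i : ℕ) :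
    (c • p).coeff i = c * p.coeff i := coeff_const_mul c p i

@[simp] theorem coeff_sub (p q : TwistedPoly σ) (i : ℕ) :
    (p - q).coeff i = p.coeff i - q.coeff i := by
  have h := coeff_add (p - q) q i
  rw [sub_add_cancel] at h
  rw [h, add_sub_cancel_right]

theorem coeff_t_pow (k i : ℕ) : (t σ ^ k).coeff i = if k = i then 1 else 0 := by
  let := twistAction σ
  have h := SkewPolynomial.monomial_one_right_eq_X_pow (R := K) k
  have h2 : (t σ ^ k).coeff i = SkewPolynomial.coeff (SkewPolynomial.monomial k (1 : K)) i := by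
    rw [h]; rfl
  rw [h2, SkewPolynomial.coeff_monomial]

/-- The degree of a twisted polynomial, with value `0` at `0`. -/
def natDegree (p : TwistedPoly σ) : ℕ := (SkewPolynomial.support (R := K) p).sup id

theorem coeff_eq_zero_of_natDegree_lt {p : TwistedPoly σ} {i : ℕ} (h : p.natDegree < i) :
    p.coeff i = 0 := by
  by_contra hc
  have : i ∈ SkewPolynomial.support (R := K) p := SkewPolynomial.mem_support_iff.2 hc
  exact absurd (Finset.le_sup (f := id) this) (not_le.2 h)

theorem coeff_natDegree_ne_zero {p : TwistedPoly σ} (hp : p ≠ 0) : p.coeff p.natDegree ≠ 0 := by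
  have hne : (SkewPolynomial.support (R := K) p).Nonempty := by
    rw [Finset.nonempty_iff_ne_empty]
    exact fun h => hp (SkewPolynomial.support_eq_empty.1 h)
  obtain ⟨i, hi, he⟩ := Finset.exists_mem_eq_sup _ hne id
  have : p.natDegree = i := he
  rw [this]
  exact SkewPolynomial.mem_support_iff.1 hi

/-- A twisted polynomial is monic if its leading coefficient is `1`. -/
def Monic (p : TwistedPoly σ) : Prop := p.coeff p.natDegree = 1

variable (σ) in
/-- The `K`-space of twisted polynomials of degree less than `m`. -/
def degreeLT (m : ℕ) : Submodule K (TwistedPoly σ) where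
  carrier := {p | ∀ i, m ≤ i → p.coeff i = 0}
  add_mem' hp hq i hi := by rw [coeff_add, hp i hi, hq i hi, add_zero]
  zero_mem' _ _ := rfl
  smul_mem' c p hp i hi := by rw [coeff_smul, hp i hi, mul_zero]

/-! ### Right division -/

theorem exists_rem {f : TwistedPoly σ} (hf : f ≠ 0) (g : TwistedPoly σ) :
    ∃ r ∈ degreeLT σ f.natDegree, ∃ q, g = q * f + r := by
  have key : ∀ N : ℕ, ∀ g ∈ degreeLT σ N, ∃ r ∈ degreeLT σ f.natDegree, ∃ q, g = q * f + r := by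
    intro N
    induction N with
    | zero =>
      intro g hg
      have : g = 0 := by
        ext i
        exact hg i (Nat.zero_le i)
      exact ⟨0, Submodule.zero_mem _, 0, by rw [this]; simp⟩
    | succ N ih =>
      intro g hg
      by_cases hN : N < f.natDegree
      · exact ⟨g, fun i hi => hg i (by omega), 0, by simp⟩
      · have hl : (σ ^ (N - f.natDegree)) (f.coeff f.natDegree) ≠ 0 :=
          (map_ne_zero_iff _ (σ ^ (N - f.natDegree)).injective).2 (coeff_natDegree_ne_zero hf)
        have hco : ∀ i, N ≤ i → (t σ ^ (N - f.natDegree) * f).coeff i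
            = if i = N then (σ ^ (N - f.natDegree)) (f.coeff f.natDegree) else 0 := by
          intro i hi
          rw [coeff_mul, Finset.sum_eq_single (N - f.natDegree, i - (N - f.natDegree))]
          · rw [coeff_t_pow, if_pos rfl, one_mul]
            split_ifs with h
            · subst h
              congr 2
              simp only
              omega
            · rw [coeff_eq_zero_of_natDegree_lt, map_zero]
              simp only
              omega
          · intro x hx hne
            have hx' := Finset.HasAntidiagonal.mem_antidiagonal.1 hx
            rw [coeff_t_pow, if_neg, zero_mul]
            intro h
            apply hne
            ext
            · exact h.symm
            · simp only
              omega
          · intro h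
            exact absurd (Finset.HasAntidiagonal.mem_antidiagonal.2 (by simp only; omega)) h
        set c := g.coeff N / (σ ^ (N - f.natDegree)) (f.coeff f.natDegree) with hc
        obtain ⟨r, hr, q, hq⟩ := ih (g - const σ c * (t σ ^ (N - f.natDegree) * f)) (by
          intro i hi
          rw [coeff_sub, coeff_const_mul, hco i hi]
          split_ifs with h
          · subst h
            rw [hc, div_mul_cancel₀ _ hl, sub_self]
          · rw [hg i (by omega), mul_zero, sub_self])
        refine ⟨r, hr, q + const σ c * t σ ^ (N - f.natDegree), ?_⟩
        rw [add_mul, mul_assoc, add_right_comm, ← hq, sub_add_cancel]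
  exact key (g.natDegree + 1) g fun i hi => coeff_eq_zero_of_natDegree_lt (by omega)

theorem eq_zero_of_mul_mem_degreeLT {f q : TwistedPoly σ} (hf : f ≠ 0)
    (h : q * f ∈ degreeLT σ f.natDegree) : q = 0 := by
  by_contra hq
  have h1 := h (q.natDegree + f.natDegree) (by omega)
  rw [coeff_mul, Finset.sum_eq_single (q.natDegree, f.natDegree)] at h1
  · rcases mul_eq_zero.1 h1 with h2 | h2
    · exact coeff_natDegree_ne_zero hq h2
    · exact coeff_natDegree_ne_zero hf ((map_eq_zero_iff _ (σ ^ q.natDegree).injective).1 h2)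
  · intro x hx hne
    have hx' := Finset.HasAntidiagonal.mem_antidiagonal.1 hx
    by_cases hlt : q.natDegree < x.1
    · rw [coeff_eq_zero_of_natDegree_lt hlt, zero_mul]
    · rw [coeff_eq_zero_of_natDegree_lt (p := f), map_zero, mul_zero]
      by_contra hle
      apply hne
      ext
      · simp only; omega
      · simp only; omega
  · intro h
    exact absurd (Finset.HasAntidiagonal.mem_antidiagonal.2 (by simp only)) h

theorem rem_unique {f r r' q q' : TwistedPoly σ} (hf : f ≠ 0) (hr : r ∈ degreeLT σ f.natDegree)
    (hr' : r' ∈ degreeLT σ f.natDegree) (h : q * f + r = q' * f + r') : r = r' := by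
  have h1 : (q - q') * f = r' - r := by
    rw [sub_mul, sub_eq_sub_iff_add_eq_add, h, add_comm]
  have h2 : q - q' = 0 :=
    eq_zero_of_mul_mem_degreeLT hf (h1 ▸ Submodule.sub_mem _ hr' hr)
  rw [h2, zero_mul] at h1
  exact (sub_eq_zero.1 h1.symm).symm

open Classical in
/-- The remainder `g mod_r f` of the division `g = q f + r`, `deg r < deg f`, of `g` by `f` from
the right. (For `f = 0`, where there is none, the value is `0`.) -/
def modr (f g : TwistedPoly σ) : TwistedPoly σ :=
  if hf : f = 0 then 0 else (exists_rem hf g).choose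

theorem modr_mem (f g : TwistedPoly σ) : modr f g ∈ degreeLT σ f.natDegree := by
  unfold modr
  split_ifs with hf
  · exact Submodule.zero_mem _
  · exact (exists_rem hf g).choose_spec.1

theorem modr_spec {f : TwistedPoly σ} (hf : f ≠ 0) (g : TwistedPoly σ) :
    ∃ q, g = q * f + modr f g := by
  unfold modr
  rw [dif_neg hf]
  exact (exists_rem hf g).choose_spec.2

theorem modr_eq {f g r q : TwistedPoly σ} (hf : f ≠ 0) (hr : r ∈ degreeLT σ f.natDegree)
    (h : g = q * f + r) : modr f g = r := by
  obtain ⟨q', hq'⟩ := modr_spec hf g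
  exact rem_unique hf (modr_mem f g) hr (hq'.symm.trans h)

theorem modr_add (f g g' : TwistedPoly σ) : modr f (g + g') = modr f g + modr f g' := by
  by_cases hf : f = 0
  · simp [modr, hf]
  · obtain ⟨q, hq⟩ := modr_spec hf g
    obtain ⟨q', hq'⟩ := modr_spec hf g'
    refine modr_eq (q := q + q') hf (Submodule.add_mem _ (modr_mem f g) (modr_mem f g')) ?_
    rw [add_mul, add_add_add_comm, ← hq, ← hq']

theorem modr_smul (c : K) (f g : TwistedPoly σ) : modr f (c • g) = c • modr f g := by
  by_cases hf : f = 0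
  · simp [modr, hf]
  · obtain ⟨q, hq⟩ := modr_spec hf g
    refine modr_eq (q := const σ c * q) hf (Submodule.smul_mem _ c (modr_mem f g)) ?_
    rw [smul_eq, smul_eq, mul_assoc, ← mul_add, ← hq]

/-! ### Bounds -/

/-- `b` is a bound `f^*` of `f`: a nonzero element for which `R b` is the largest two-sided ideal
of `R` contained in `R f`. (`Ideal R` is the type of left ideals of `R`, and `Ideal.span {b}` is
the left ideal `R b`.) -/
def IsBound (f b : TwistedPoly σ) : Prop :=
  b ≠ 0 ∧ IsGreatest {I : Ideal (TwistedPoly σ) | I.IsTwoSided ∧ I ≤ Ideal.span {f}}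
    (Ideal.span {b})

variable (σ) in
/-- The twisted polynomial `ĥ(t^n)`, `n = [K : F]`, for `ĥ ∈ F[x]`. -/
def evalTPow (h : F[X]) : TwistedPoly σ :=
  h.eval₂ ((const σ).comp (algebraMap F K)) (t σ ^ Module.finrank F K)

end TwistedPoly

/-! ### Petit algebras -/

open TwistedPoly

/-- The Petit algebra `S_f = R/Rf`: the twisted polynomials of degree less than `deg f`, multiplied
by `g ∘ h = gh mod_r f`. -/
def PetitAlgebra {σ : K ≃ₐ[F] K} (f : TwistedPoly σ) : Type _ := degreeLT σ f.natDegree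

namespace PetitAlgebra

variable {σ : K ≃ₐ[F] K} {f : TwistedPoly σ}

instance : AddCommGroup (PetitAlgebra f) := inferInstanceAs (AddCommGroup (degreeLT σ f.natDegree))

/-- `K` acts by left multiplication. -/
instance : Module K (PetitAlgebra f) := inferInstanceAs (Module K (degreeLT σ f.natDegree))

/-- The twisted polynomial of degree less than `deg f` underlying an element of `S_f`. -/
def toPoly : PetitAlgebra f →ₗ[K] TwistedPoly σ := (degreeLT σ f.natDegree).subtype

theorem toPoly_injective : Function.Injective (toPoly : PetitAlgebra f → TwistedPoly σ) :=
  Subtype.val_injective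

instance : Mul (PetitAlgebra f) := ⟨fun a b => ⟨modr f (toPoly a * toPoly b), modr_mem _ _⟩⟩

theorem toPoly_mul (a b : PetitAlgebra f) : toPoly (a * b) = modr f (toPoly a * toPoly b) := rfl

instance : NonUnitalNonAssocRing (PetitAlgebra f) where
  left_distrib a b c := toPoly_injective <| by
    simp only [toPoly_mul, map_add, mul_add, modr_add]
  right_distrib a b c := toPoly_injective <| by
    simp only [toPoly_mul, map_add, add_mul, modr_add]
  zero_mul a := toPoly_injective <| by
    have h := modr_smul 0 f 0
    simp only [zero_smul] at h
    simp only [toPoly_mul, map_zero, zero_mul, h]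
  mul_zero a := toPoly_injective <| by
    have h := modr_smul 0 f 0
    simp only [zero_smul] at h
    simp only [toPoly_mul, map_zero, mul_zero, h]

/-- The right multiplication `R_a : x ↦ x a` of `S_f`, a `K`-linear map. -/
def rightMul (a : PetitAlgebra f) : PetitAlgebra f →ₗ[K] PetitAlgebra f where
  toFun x := x * a
  map_add' x y := add_mul x y a
  map_smul' c x := toPoly_injective <| by
    simp only [toPoly_mul, map_smul, RingHom.id_apply, smul_eq, mul_assoc]
    rw [← smul_eq, modr_smul, smul_eq]

/-- The matrix code `{R_a | a ∈ S_f}` in `M_m(K)`, the `K`-linear maps `R_a` being written as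
matrices in the `K`-basis `b` of `S_f`. -/
def code {m : ℕ} (b : Module.Basis (Fin m) K (PetitAlgebra f)) : Set (Matrix (Fin m) (Fin m) K) :=
  {M | ∃ a : PetitAlgebra f, M = LinearMap.toMatrix b b (rightMul a)}

end PetitAlgebra

/-! ### Matrix codes -/

variable (F) in
/-- `C ⊆ M_m(K)` is an `F`-linear maximum rank distance code: an `F`-subspace whose dimension
attains the Singleton bound `[K : F] m (m - d + 1)`, where `d` is the minimum rank distance
of `C`. -/
def IsLinearMRD {m : ℕ} (C : Set (Matrix (Fin m) (Fin m) K)) : Prop :=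
  ∃ V : Submodule F (Matrix (Fin m) (Fin m) K), (V : Set (Matrix (Fin m) (Fin m) K)) = C ∧
    ∃ d : ℕ, IsLeast {r | ∃ A ∈ C, ∃ B ∈ C, A ≠ B ∧ r = (A - B).rank} d ∧
      Module.finrank F V = Module.finrank F K * (m * (m - d + 1))

/-- `C` and `C'` are equivalent: `C' = X C^φ Y` for a ring automorphism `φ` of `M_m(K)` and
invertible matrices `X, Y`. -/
def CodeEquivalent {m : ℕ} (C C' : Set (Matrix (Fin m) (Fin m) K)) : Prop :=
  ∃ (φ : Matrix (Fin m) (Fin m) K ≃+* Matrix (Fin m) (Fin m) K) (X Y : GL (Fin m) K),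
    C' = {B | ∃ A ∈ C, B = X.val * φ A * Y.val}

/-! ### The group `G` and its action -/

variable (F K) in
/-- The group `N_{K/F}(K^×)` of nonzero norms, as a subgroup of `F^×`. -/
def normGroup : Subgroup Fˣ := (Units.map (Algebra.norm F : K →* F)).range

/-- The group of the automorphisms `τ` of `K` with `σ τ = τ σ` and `τ(F) = F`. -/
def stableAut (σ : K ≃ₐ[F] K) : Subgroup (RingAut K) where
  carrier := {τ | (∀ a, σ (τ a) = τ (σ a)) ∧
    τ '' Set.range (algebraMap F K) = Set.range (algebraMap F K)}
  one_mem' := ⟨fun _ => rfl, Set.image_id _⟩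
  mul_mem' {τ τ'} h h' := by
    refine ⟨fun a => ?_, ?_⟩
    · rw [RingAut.mul_apply, RingAut.mul_apply, h.1, h'.1]
    · rw [show ⇑(τ * τ') = τ ∘ τ' from rfl, Set.image_comp, h'.2, h.2]
  inv_mem' {τ} h := by
    refine ⟨fun a => ?_, ?_⟩
    · apply τ.injective
      rw [← h.1]
      simp only [← RingAut.mul_apply, mul_inv_cancel, RingAut.one_apply]
    · conv_lhs => rw [← h.2]
      rw [← Set.image_comp, ← show ⇑(τ⁻¹ * τ) = ⇑(τ⁻¹) ∘ ⇑τ from rfl, inv_mul_cancel]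
      exact Set.image_id _

namespace stableAut

variable {σ : K ≃ₐ[F] K}

theorem exists_restrict (τ : stableAut σ) (a : F) :
    ∃ b : F, algebraMap F K b = τ.1 (algebraMap F K a) := by
  have h : τ.1 (algebraMap F K a) ∈ Set.range (algebraMap F K) := by
    rw [← τ.2.2]
    exact ⟨_, ⟨a, rfl⟩, rfl⟩
  exact h

/-- The restriction `τ|_F`, as a map. -/
def restrictFun (τ : stableAut σ) (a : F) : F := (exists_restrict τ a).choose

@[simp] theorem algebraMap_restrictFun (τ : stableAut σ) (a : F) :
    algebraMap F K (restrictFun τ a) = τ.1 (algebraMap F K a) :=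
  (exists_restrict τ a).choose_spec

theorem restrictFun_mul (τ τ' : stableAut σ) (a : F) :
    restrictFun (τ * τ') a = restrictFun τ (restrictFun τ' a) :=
  (algebraMap F K).injective <| by simp

theorem restrictFun_one (a : F) : restrictFun (1 : stableAut σ) a = a :=
  (algebraMap F K).injective <| by simp

variable (σ) in
/-- The restriction `τ ↦ τ|_F`. -/
def restrict : stableAut σ →* RingAut F where
  toFun τ :=
    { toFun := restrictFun τ
      invFun := restrictFun τ⁻¹
      left_inv := fun a => by rw [← restrictFun_mul, inv_mul_cancel, restrictFun_one]
      right_inv := fun a => by rw [← restrictFun_mul, mul_inv_cancel, restrictFun_one]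
      map_mul' := fun a b => (algebraMap F K).injective <| by simp
      map_add' := fun a b => (algebraMap F K).injective <| by simp }
  map_one' := RingEquiv.ext restrictFun_one
  map_mul' τ τ' := RingEquiv.ext (restrictFun_mul τ τ')

@[simp] theorem algebraMap_restrict (τ : stableAut σ) (a : F) :
    algebraMap F K (restrict σ τ a) = τ.1 (algebraMap F K a) := algebraMap_restrictFun τ a

theorem norm_apply (τ : stableAut σ) (a : K) :
    Algebra.norm F (τ.1 a) = restrict σ τ (Algebra.norm F a) := by
  rw [Algebra.norm_eq_of_equiv_equiv (restrict σ τ) τ.1 (RingHom.ext (by simp)) a,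
    RingEquiv.apply_symm_apply]

theorem map_mem_normGroup (τ : stableAut σ) {l : Fˣ} (hl : l ∈ normGroup F K) :
    Units.map (restrict σ τ : F →* F) l ∈ normGroup F K := by
  obtain ⟨a, rfl⟩ := hl
  exact ⟨Units.map (τ.1 : K →* K) a, Units.ext (norm_apply τ a)⟩

/-- `τ` acts on the norms by `λ ↦ τ(λ)`. -/
instance : MulDistribMulAction (stableAut σ) (normGroup F K) where
  smul τ l := ⟨Units.map (restrict σ τ : F →* F) l.1, map_mem_normGroup τ l.2⟩
  one_smul l := Subtype.ext <| Units.ext <| by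
    change restrict σ 1 (l.1 : F) = l.1
    rw [map_one, RingAut.one_apply]
  mul_smul τ τ' l := Subtype.ext <| Units.ext <| by
    change restrict σ (τ * τ') (l.1 : F) = restrict σ τ (restrict σ τ' (l.1 : F))
    rw [map_mul, RingAut.mul_apply]
  smul_mul τ l l' := Subtype.ext (map_mul (Units.map (restrict σ τ : F →* F)) l.1 l'.1)
  smul_one τ := Subtype.ext (map_one (Units.map (restrict σ τ : F →* F)))

end stableAut

/-- The group `G = N_{K/F}(K^×) ⋊ {τ ∈ Aut(K) | στ = τσ, τ(F) = F}` of pairs `(λ, τ)`. -/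
abbrev OrbitGroup (σ : K ≃ₐ[F] K) : Type _ :=
  normGroup F K ⋊[MulDistribMulAction.toMulAut (stableAut σ) (normGroup F K)] stableAut σ

variable (F) in
/-- The set `I(F, m₀)` of monic irreducible polynomials of degree `m₀` in `F[x]`. -/
def MonicIrreducible (m₀ : ℕ) : Type _ := {h : F[X] // h.Monic ∧ Irreducible h ∧ h.natDegree = m₀}

/-- `λ^{-m₀} h^τ(λ x)`, where `τ` acts on the coefficients of `h`. -/
def twist (m₀ : ℕ) (l : Fˣ) (τ : RingAut F) (h : F[X]) : F[X] :=
  C ((l : F)⁻¹ ^ m₀) * (h.map (τ : F →+* F)).comp (C (l : F) * X)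

theorem coeff_twist (m₀ : ℕ) (l : Fˣ) (τ : RingAut F) (h : F[X]) (i : ℕ) :
    (twist m₀ l τ h).coeff i = (l : F)⁻¹ ^ m₀ * (τ (h.coeff i) * (l : F) ^ i) := by
  simp [twist, comp_C_mul_X_coeff]

theorem twist_one (m₀ : ℕ) (h : F[X]) : twist m₀ 1 1 h = h := by
  ext i
  simp [coeff_twist]

theorem twist_twist (m₀ : ℕ) (l l' : Fˣ) (τ τ' : RingAut F) (h : F[X]) :
    twist m₀ l τ (twist m₀ l' τ' h)
      = twist m₀ (l * Units.map (τ : F →* F) l') (τ * τ') h := by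
  ext i
  simp only [coeff_twist, map_mul, map_pow, map_inv₀, Units.val_mul, mul_inv, mul_pow,
    RingAut.mul_apply, Units.coe_map]
  simp only [MonoidHom.coe_coe]
  ring

theorem twist_mem {m₀ : ℕ} (l : Fˣ) (τ : RingAut F) {h : F[X]}
    (hh : h.Monic ∧ Irreducible h ∧ h.natDegree = m₀) :
    (twist m₀ l τ h).Monic ∧ Irreducible (twist m₀ l τ h) ∧ (twist m₀ l τ h).natDegree = m₀ := by
  obtain ⟨hm, hi, hd⟩ := hh
  have hl : (l : F) ≠ 0 := l.ne_zero
  have hdeg : (twist m₀ l τ h).natDegree = m₀ := by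
    rw [twist, natDegree_C_mul (pow_ne_zero _ (inv_ne_zero hl)), natDegree_comp,
      natDegree_C_mul_X _ hl, mul_one, natDegree_map_eq_of_injective τ.injective, hd]
  refine ⟨?_, ?_, hdeg⟩
  · rw [Polynomial.Monic, leadingCoeff, hdeg, coeff_twist, ← hd, hm.coeff_natDegree, map_one, one_mul,
      ← mul_pow, inv_mul_cancel₀ hl, one_pow]
  · rw [twist, irreducible_isUnit_mul
      (isUnit_C.2 (pow_ne_zero _ (inv_ne_zero hl)).isUnit)]
    have h1 : Irreducible (h.map (τ : F →+* F)) :=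
      (MulEquiv.irreducible_iff (mapEquiv τ)).2 hi
    have h2 := (MulEquiv.irreducible_iff (algEquivCMulXAddC (l : F) 0)).2 h1
    simpa [comp_eq_aeval] using h2

instance (σ : K ≃ₐ[F] K) (m₀ : ℕ) : MulAction (OrbitGroup σ) (MonicIrreducible F m₀) where
  smul γ h := ⟨twist m₀ γ.left.1 (stableAut.restrict σ γ.right) h.1, twist_mem _ _ h.2⟩
  one_smul h := Subtype.ext <| by
    change twist m₀ 1 (stableAut.restrict σ 1) h.1 = h.1
    rw [map_one, twist_one]
  mul_smul γ γ' h := Subtype.ext <| by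
    change twist m₀ _ (stableAut.restrict σ (γ.right * γ'.right)) h.1
      = twist m₀ _ _ (twist m₀ _ _ h.1)
    rw [map_mul, twist_twist]
    rfl

end PetitCode

end

noncomputable section

open Polynomial

namespace PetitCode

variable {F K : Type*} [Field F] [Field K] [Algebra F K]

/-! ### Left ideals -/

/-! Left ideals of `R` are principal, so for irreducible `f` the ideal `Rf` is maximal and `R/Rf` is
simple. If `R_a` with `a ≠ 0` had a kernel, division with remainder would make it surjective, which
is absurd in finite dimension. So nonzero codewords are invertible, `d = m`, and `dim_F S_f = nm`
meets the Singleton bound (`isLinearMRD_code`).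

For the equivalence, an element `(λ, τ)` of `G` with `λ = N(a)` gives the substitution `Ψ : c ↦
τ(c), t ↦ at`. As `(at)^n = λ t^n`, it sends `f^*` to `λ^{m₀} g^*` (`subst_evalTPow`), so the left
ideal `J = Ψ⁻¹(Rg)` contains `Rf^*`, hence the annihilator of `R/Rf`. That annihilator is cut out by
finitely many vectors, because `F` is central and `S_f` is finite over `F`. A module-theoretic
argument (`exists_notMem_forall_mul_mem`) then yields `u ∉ J` with `(Rf)u ⊆ J`, and simplicity makes
`x ↦ xu` an injection `R/Rf → R/J`. The maps `T x = Ψ(x)` and `S x = Ψ(xu) mod g` are `τ`-semilinear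
bijections `S_f → S_g` with `R_{S c} T = S R_c`; in bases this says `C' = X C^τ Y`. -/

/-- If a left ideal `J ≠ R` contains a finite intersection of left ideals `(I : vᵢ)`, where `I` is a
maximal left ideal, then right multiplication by some `u` gives a nonzero map `R/I → R/J`. -/
theorem exists_notMem_forall_mul_mem {R ι : Type*} [Ring R] {I J : Ideal R} (hI : I.IsMaximal)
    (hJ : (1 : R) ∉ J) (v : ι → R) (s : Finset ι) (h : ∀ x, (∀ i ∈ s, x * v i ∈ I) → x ∈ J) :
    ∃ u ∉ J, ∀ x ∈ I, x * u ∈ J := by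
  classical
  induction s using Finset.induction_on with
  | empty => exact absurd (h 1 (by simp)) hJ
  | insert j s _ ih =>
    by_cases hs : ∀ x, (∀ i ∈ s, x * v i ∈ I) → x ∈ J
    · exact ih hs
    push Not at hs
    -- Here `j` is indispensable: `l` kills the other `vᵢ` modulo `I`, but not `v j`. A multiple `u
    -- = c * l` then sends `v j` to `1` modulo `I` and the other `vᵢ` to `0`.
    obtain ⟨l, hl, hlJ⟩ := hs
    have hmem : ∀ x, (∀ i ∈ s, x * v i ∈ I) → x * v j ∈ I → x ∈ J := fun x hx hxj =>
      h x fun i hi => by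
        rcases Finset.mem_insert.1 hi with rfl | hi
        · exact hxj
        · exact hx i hi
    have hlI : l * v j ∉ I := fun hc => hlJ (hmem l hl hc)
    have htop : I ⊔ Ideal.span {l * v j} = ⊤ := hI.out.2 _ <|
      lt_of_le_of_ne le_sup_left fun he =>
        hlI (he ▸ Ideal.mem_sup_right (Ideal.mem_span_singleton_self _))
    obtain ⟨i₀, hi₀, z, hz, hsum⟩ := Submodule.mem_sup.1 ((Ideal.eq_top_iff_one _).1 htop)
    obtain ⟨c, rfl⟩ := Ideal.mem_span_singleton'.1 hz
    have hu : ∀ y, ∀ i ∈ s, y * (c * l) * v i ∈ I := fun y i hi => by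
      rw [← mul_assoc, mul_assoc (y * c)]
      exact I.mul_mem_left _ (hl i hi)
    have hone : c * l * v j = 1 - i₀ := by
      rw [← hsum, add_sub_cancel_left, mul_assoc]
    refine ⟨c * l, fun hc => hlJ ?_, fun x hx => hmem _ (hu x) ?_⟩
    -- `l` and `l * v j * u` act alike on all the `vᵢ` modulo `I`, so they agree modulo `J`; thus `u
    -- ∈ J` would force `l ∈ J`.
    · have h1 : l - l * v j * (c * l) ∈ J := by
        refine hmem _ (fun i hi => ?_) ?_
        · rw [sub_mul]
          exact I.sub_mem (hl i hi) (hu _ i hi)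
        · rw [sub_mul, mul_assoc _ (c * l), hone, mul_sub, mul_one, sub_sub_cancel]
          exact I.mul_mem_left _ hi₀
      have h2 := J.add_mem h1 (J.mul_mem_left (l * v j) hc)
      rwa [sub_add_cancel] at h2
    · rw [mul_assoc, hone, mul_sub, mul_one]
      exact I.sub_mem hx (I.mul_mem_left _ hi₀)

/-! ### Remainders and left ideals of `K[t;σ]` -/

namespace TwistedPoly

variable {σ : K ≃ₐ[F] K}

theorem coeff_one (i : ℕ) : (1 : TwistedPoly σ).coeff i = if 0 = i then 1 else 0 := by
  rw [← pow_zero (t σ), coeff_t_pow]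

theorem coeff_const_mul_t_pow (c : K) (k i : ℕ) :
    (const σ c * t σ ^ k).coeff i = if k = i then c else 0 := by
  rw [coeff_const_mul, coeff_t_pow, mul_ite, mul_one, mul_zero]

theorem coeff_sum {ι : Type*} (s : Finset ι) (p : ι → TwistedPoly σ) (i : ℕ) :
    (∑ j ∈ s, p j).coeff i = ∑ j ∈ s, (p j).coeff i :=
  map_sum (⟨⟨fun p => p.coeff i, coeff_zero i⟩, fun p q => coeff_add p q i⟩ : TwistedPoly σ →+ K) p s

theorem natDegree_lt_of_mem_degreeLT {p : TwistedPoly σ} (hp : p ≠ 0) {m : ℕ}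
    (h : p ∈ degreeLT σ m) : p.natDegree < m := by
  by_contra hc
  exact coeff_natDegree_ne_zero hp (h _ (not_lt.1 hc))

theorem modr_eq_zero_iff {f : TwistedPoly σ} (hf : f ≠ 0) (p : TwistedPoly σ) :
    modr f p = 0 ↔ p ∈ Ideal.span {f} := by
  rw [Ideal.mem_span_singleton']
  constructor
  · intro h
    obtain ⟨q, hq⟩ := modr_spec hf p
    exact ⟨q, by rw [hq, h, add_zero]⟩
  · rintro ⟨q, rfl⟩
    exact modr_eq hf (Submodule.zero_mem _) (add_zero _).symm

theorem sub_modr_mem {f : TwistedPoly σ} (hf : f ≠ 0) (p : TwistedPoly σ) :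
    p - modr f p ∈ Ideal.span {f} := by
  obtain ⟨q, hq⟩ := modr_spec hf p
  exact Ideal.mem_span_singleton'.2 ⟨q, eq_sub_of_add_eq hq.symm⟩

theorem modr_congr {f : TwistedPoly σ} (hf : f ≠ 0) {p p' : TwistedPoly σ}
    (h : p - p' ∈ Ideal.span {f}) : modr f p = modr f p' := by
  have h1 := modr_add f (p - p') p'
  rwa [sub_add_cancel, (modr_eq_zero_iff hf _).2 h, zero_add] at h1

theorem eq_zero_of_mem_span {f p : TwistedPoly σ} (hf : f ≠ 0) (hp : p ∈ degreeLT σ f.natDegree)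
    (h : p ∈ Ideal.span {f}) : p = 0 := by
  rw [← (modr_eq_zero_iff hf p).2 h]
  exact (modr_eq (q := 0) hf hp (by rw [zero_mul, zero_add])).symm

/-- Every left ideal of `K[t;σ]` is principal. -/
theorem exists_eq_span_singleton (I : Ideal (TwistedPoly σ)) : ∃ d, I = Ideal.span {d} := by
  classical
  by_cases hI : ∃ p ∈ I, p ≠ 0
  · have hex : ∃ k, ∃ p ∈ I, p ≠ 0 ∧ p.natDegree = k := by
      obtain ⟨p, hp, h0⟩ := hI
      exact ⟨_, p, hp, h0, rfl⟩
    obtain ⟨d, hd, h0, hdeg⟩ := Nat.find_spec hex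
    refine ⟨d, le_antisymm (fun p hp => ?_) ((Ideal.span_singleton_le_iff_mem I).2 hd)⟩
    rw [← modr_eq_zero_iff h0]
    by_contra hne
    have hmem : modr d p ∈ I := by
      have h1 := I.sub_mem hp ((Ideal.span_singleton_le_iff_mem I).2 hd (sub_modr_mem h0 p))
      rwa [sub_sub_cancel] at h1
    exact Nat.find_min hex (hdeg ▸ natDegree_lt_of_mem_degreeLT hne (modr_mem d p))
      ⟨_, hmem, hne, rfl⟩
  · push Not at hI
    refine ⟨0, le_antisymm (fun p hp => by rw [hI p hp]; exact Submodule.zero_mem _) ?_⟩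
    exact (Ideal.span_singleton_le_iff_mem I).2 I.zero_mem

theorem isMaximal_span_of_irreducible {f : TwistedPoly σ} (hf : Irreducible f) :
    (Ideal.span {f}).IsMaximal := by
  refine ⟨⟨fun h => hf.not_isUnit ?_, fun J hJ => ?_⟩⟩
  · obtain ⟨q, hq⟩ := Ideal.mem_span_singleton'.1 ((Ideal.eq_top_iff_one _).1 h)
    -- The left inverse `q` of `f` is also a right inverse, by cancelling `f` on the right in `f q f
    -- = f`.
    have h0 : f * q = 1 := by
      have hf0 := hf.ne_zero
      have h1 : (f * q - 1) * f = 0 := by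
        rw [sub_mul, mul_assoc, hq, mul_one, one_mul, sub_self]
      exact sub_eq_zero.1 (eq_zero_of_mul_mem_degreeLT hf0 (h1 ▸ Submodule.zero_mem _))
    exact ⟨⟨f, q, h0, hq⟩, rfl⟩
  · obtain ⟨d, rfl⟩ := exists_eq_span_singleton J
    obtain ⟨q, hq⟩ := Ideal.mem_span_singleton'.1 (hJ.le (Ideal.mem_span_singleton_self f))
    rcases hf.isUnit_or_isUnit hq.symm with h | h
    · exfalso
      obtain ⟨w, hw⟩ := h.exists_left_inv
      refine hJ.not_ge ((Ideal.span_singleton_le_iff_mem _).2 ?_)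
      exact Ideal.mem_span_singleton'.2 ⟨w, by rw [← hq, ← mul_assoc, hw, one_mul]⟩
    · exact Ideal.eq_top_of_isUnit_mem _ (Ideal.mem_span_singleton_self d) h

theorem one_notMem_span {f : TwistedPoly σ} (hf : Irreducible f) : 1 ∉ Ideal.span {f} :=
  fun h => (isMaximal_span_of_irreducible hf).ne_top ((Ideal.eq_top_iff_one _).2 h)

theorem natDegree_pos_of_irreducible {f : TwistedPoly σ} (hf : Irreducible f) :
    0 < f.natDegree := by
  rw [Nat.pos_iff_ne_zero]
  intro h
  have h0 := (modr_eq_zero_iff hf.ne_zero 1).1 <| ext fun i => modr_mem f 1 i (by omega)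
  exact one_notMem_span hf h0

/-- `σ` fixes `F`, so `F` is central in `R`. This makes the code `F`-linear and lets annihilation be
tested on an `F`-basis. -/
theorem const_algebraMap_mul_comm (c : F) (p : TwistedPoly σ) :
    const σ (algebraMap F K c) * p = p * const σ (algebraMap F K c) := by
  ext i
  have hc : ∀ j, (const σ (algebraMap F K c)).coeff j = if 0 = j then algebraMap F K c else 0 := by
    intro j
    simpa using coeff_const_mul_t_pow (σ := σ) (algebraMap F K c) 0 j
  rw [coeff_const_mul, coeff_mul, Finset.sum_eq_single (i, 0)]
  · rw [hc, if_pos rfl, AlgEquiv.commutes, mul_comm]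
  · rintro ⟨a, b⟩ hab hne
    have hb : b ≠ 0 := by
      rintro rfl
      exact hne (by simpa using hab)
    rw [hc, if_neg (Ne.symm hb), map_zero, mul_zero]
  · simp

end TwistedPoly

open TwistedPoly

/-! ### Invertibility of right multiplications and the MRD property -/

namespace PetitAlgebra

variable {σ : K ≃ₐ[F] K} {f : TwistedPoly σ}

theorem toPoly_mem (a : PetitAlgebra f) : toPoly a ∈ degreeLT σ f.natDegree :=
  Subtype.property (p := (· ∈ degreeLT σ f.natDegree)) a

/-- The element of `S_f` represented by a twisted polynomial. -/
def ofPoly (f p : TwistedPoly σ) : PetitAlgebra f := ⟨modr f p, modr_mem f p⟩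

theorem toPoly_ofPoly (p : TwistedPoly σ) : toPoly (ofPoly f p) = modr f p := rfl

theorem ofPoly_add (p q : TwistedPoly σ) : ofPoly f (p + q) = ofPoly f p + ofPoly f q :=
  toPoly_injective <| by
    rw [map_add]
    exact modr_add f p q

/-- Maximality gives `Rf + Ra = R`, so every `y` is `c a` modulo `Rf`. Since `x a ∈ Rf`, the factor
`c` may be replaced by its remainder modulo `x`, whose degree is below `deg x < deg f`, so it lies
in `S_f`. -/
theorem rightMul_surjective_of_ne_zero (hf : Irreducible f) {a x : PetitAlgebra f} (ha : a ≠ 0)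
    (hx : x ≠ 0) (h : x * a = 0) : Function.Surjective (rightMul a) := by
  have hf0 := hf.ne_zero
  have ha0 : toPoly a ≠ 0 := fun h0 => ha (toPoly_injective (h0.trans (map_zero _).symm))
  have hx0 : toPoly x ≠ 0 := fun h0 => hx (toPoly_injective (h0.trans (map_zero _).symm))
  have hxa : toPoly x * toPoly a ∈ Ideal.span {f} := by
    rw [← modr_eq_zero_iff hf0, ← toPoly_mul, h, map_zero]
  have hlt : Ideal.span {f} < Ideal.span {f} ⊔ Ideal.span {toPoly a} :=
    lt_of_le_of_ne le_sup_left fun he => ha0 <| eq_zero_of_mem_span hf0 (toPoly_mem a) <|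
      he ▸ Ideal.mem_sup_right (Ideal.mem_span_singleton_self _)
  have htop := (isMaximal_span_of_irreducible hf).out.2 _ hlt
  intro y
  obtain ⟨p, hp, z, hz, hy⟩ := Submodule.mem_sup.1 (htop ▸ Submodule.mem_top : toPoly y ∈ _)
  obtain ⟨c, rfl⟩ := Ideal.mem_span_singleton'.1 hz
  obtain ⟨q, hq⟩ := modr_spec hx0 c
  refine ⟨⟨modr (toPoly x) c, fun i hi => modr_mem (toPoly x) c i ?_⟩, toPoly_injective ?_⟩
  · exact (natDegree_lt_of_mem_degreeLT hx0 (toPoly_mem x)).le.trans hi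
  · have hy' : modr f (toPoly y) = toPoly y := modr_eq (q := 0) hf0 (toPoly_mem y) (by simp)
    refine Eq.trans ?_ hy'
    refine modr_congr hf0 ?_
    change modr (toPoly x) c * toPoly a - toPoly y ∈ _
    have he : modr (toPoly x) c * toPoly a - toPoly y = -(p + q * (toPoly x * toPoly a)) := by
      rw [← hy, eq_sub_of_add_eq' hq.symm]
      noncomm_ring
    rw [he]
    exact neg_mem (add_mem hp (Ideal.mul_mem_left _ _ hxa))

theorem rightMul_injective [Module.Finite K (PetitAlgebra f)] (hf : Irreducible f)
    {a : PetitAlgebra f} (ha : a ≠ 0) : Function.Injective (rightMul a) := by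
  by_contra hinj
  obtain ⟨x, hxa, hx⟩ : ∃ x, rightMul a x = 0 ∧ x ≠ 0 := by
    by_contra! hc
    exact hinj ((injective_iff_map_eq_zero _).2 hc)
  exact hinj (LinearMap.injective_iff_surjective.2 (rightMul_surjective_of_ne_zero hf ha hx hxa))

theorem rank_toMatrix_rightMul (hf : Irreducible f) {m : ℕ}
    (b : Module.Basis (Fin m) K (PetitAlgebra f)) {a : PetitAlgebra f} (ha : a ≠ 0) :
    (LinearMap.toMatrix b b (rightMul a)).rank = m := by
  have : Module.Finite K (PetitAlgebra f) := Module.Finite.of_basis b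
  have h := LinearMap.injective_iff_surjective.1 (rightMul_injective hf ha)
  rw [Matrix.rank_eq_finrank_range_toLin _ b b, Matrix.toLin_toMatrix, LinearMap.range_eq_top.2 h,
    finrank_top, Module.finrank_eq_card_basis b, Fintype.card_fin]

theorem rightMul_add (a a' : PetitAlgebra f) : rightMul (a + a') = rightMul a + rightMul a' :=
  LinearMap.ext fun x => mul_add x a a'

theorem rightMul_smul (c : F) (a : PetitAlgebra f) :
    rightMul (algebraMap F K c • a) = algebraMap F K c • rightMul a :=
  LinearMap.ext fun x => toPoly_injective <| by
    change modr f (toPoly x * toPoly (algebraMap F K c • a))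
      = toPoly (algebraMap F K c • (x * a))
    rw [map_smul, map_smul, toPoly_mul, ← modr_smul, smul_eq, smul_eq, ← mul_assoc,
      ← const_algebraMap_mul_comm, mul_assoc]

theorem isLinearMRD_code [FiniteDimensional F K] (hf : Irreducible f) {m : ℕ} (hm : 0 < m)
    (b : Module.Basis (Fin m) K (PetitAlgebra f)) : IsLinearMRD F (code b) := by
  let : Module F (PetitAlgebra f) := Module.compHom _ (algebraMap F K)
  have : IsScalarTower F K (PetitAlgebra f) := IsScalarTower.of_algebraMap_smul fun _ _ => rfl
  let L : PetitAlgebra f →ₗ[F] Matrix (Fin m) (Fin m) K :=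
    { toFun := fun a => LinearMap.toMatrix b b (rightMul a)
      map_add' := fun a a' => by rw [rightMul_add, map_add]
      map_smul' := fun c a => by
        rw [← algebraMap_smul K c a, rightMul_smul, map_smul, algebraMap_smul, RingHom.id_apply] }
  have hrank : ∀ a a', a ≠ a' → (L a - L a').rank = m := fun a a' h => by
    rw [← map_sub]
    exact rank_toMatrix_rightMul hf b (sub_ne_zero.2 h)
  have hinj : Function.Injective L := fun a a' h => by
    by_contra hne
    have := hrank a a' hne
    rw [h, sub_self, Matrix.rank_zero] at this
    omega
  have hcode : (LinearMap.range L : Set (Matrix (Fin m) (Fin m) K)) = code b := by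
    ext M
    exact exists_congr fun _ => eq_comm
  refine ⟨LinearMap.range L, hcode, m, ⟨?_, ?_⟩, ?_⟩
  -- The distance `m` must be attained, which takes two distinct codewords; here `0 < m` is needed.
  · have hb : b ⟨0, hm⟩ ≠ 0 := b.ne_zero _
    exact ⟨_, ⟨_, rfl⟩, _, ⟨_, rfl⟩, hinj.ne hb, (hrank _ _ hb).symm⟩
  · rintro r ⟨_, ⟨a, rfl⟩, _, ⟨a', rfl⟩, hne, rfl⟩
    exact (hrank a a' fun h => hne (by rw [h])).ge
  · rw [LinearMap.finrank_range_of_inj hinj, ← Module.finrank_mul_finrank F K,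
      Module.finrank_eq_card_basis b, Fintype.card_fin, Nat.sub_self, zero_add, mul_one]

end PetitAlgebra

/-! ### Semilinear bijections and equivalence of codes -/

/-- The image of a basis under an injective semilinear map of spaces of the same dimension. -/
theorem exists_basis_of_semilinear {V W : Type*} [AddCommGroup V] [Module K V] [AddCommGroup W]
    [Module K W] {m : ℕ} (bV : Module.Basis (Fin m) K V) (bW : Module.Basis (Fin m) K W)
    (τ : RingAut K) (T : V →+ W) (hT : ∀ x, T x = 0 → x = 0)
    (hτ : ∀ (c : K) x, T (c • x) = τ c • T x) :
    ∃ b : Module.Basis (Fin m) K W, ∀ i, b i = T (bV i) := by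
  have hli : LinearIndependent K (T ∘ bV) :=
    -- The criterion pulls scalars back from `W` to `V`, hence `τ⁻¹`.
    bV.linearIndependent.map_of_injective_injective (τ⁻¹ : RingAut K) T
      (fun r hr => (map_eq_zero_iff _ (τ⁻¹ : RingAut K).injective).1 hr) hT fun r x => by
        rw [hτ, ← RingAut.mul_apply, mul_inv_cancel, RingAut.one_apply]
  have : Module.Finite K W := Module.Finite.of_basis bW
  exact ⟨basisOfLinearIndependentOfCardEqFinrank' _ hli (Module.finrank_eq_card_basis bW).symm,
    fun i => by simp⟩

theorem repr_semilinear {V W : Type*} [AddCommGroup V] [Module K V] [AddCommGroup W]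
    [Module K W] {m : ℕ} (bV : Module.Basis (Fin m) K V) (b : Module.Basis (Fin m) K W)
    (τ : RingAut K) (T : V →+ W) (hτ : ∀ (c : K) x, T (c • x) = τ c • T x)
    (hb : ∀ i, b i = T (bV i)) (x : V) (i : Fin m) : b.repr (T x) i = τ (bV.repr x i) := by
  have h : T x = ∑ j, τ (bV.repr x j) • b j := by
    conv_lhs => rw [← bV.sum_repr x]
    simp only [map_sum, hτ, hb]
  rw [h, Module.Basis.repr_sum_self]

theorem surjective_of_semilinear {V W : Type*} [AddCommGroup V] [Module K V] [AddCommGroup W]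
    [Module K W] {m : ℕ} (bV : Module.Basis (Fin m) K V) (bW : Module.Basis (Fin m) K W)
    (τ : RingAut K) (T : V →+ W) (hT : ∀ x, T x = 0 → x = 0)
    (hτ : ∀ (c : K) x, T (c • x) = τ c • T x) : Function.Surjective T := by
  obtain ⟨b, hb⟩ := exists_basis_of_semilinear bV bW τ T hT hτ
  intro y
  refine ⟨∑ i, (τ⁻¹ : RingAut K) (b.repr y i) • bV i, ?_⟩
  conv_rhs => rw [← b.sum_repr y]
  simp only [map_sum, hτ, ← RingAut.mul_apply, mul_inv_cancel, RingAut.one_apply, hb]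

/-- Codes are equivalent if the corresponding endomorphisms are intertwined by semilinear
bijections. -/
theorem codeEquivalent_of_semilinear {V W α : Type*} [AddCommGroup V] [Module K V]
    [AddCommGroup W] [Module K W] {m : ℕ} (bV : Module.Basis (Fin m) K V)
    (bW : Module.Basis (Fin m) K W) (τ : RingAut K) (T S : V →+ W) (hT : ∀ x, T x = 0 → x = 0)
    (hTτ : ∀ (c : K) x, T (c • x) = τ c • T x) (hS : ∀ x, S x = 0 → x = 0)
    (hSτ : ∀ (c : K) x, S (c • x) = τ c • S x) (A : α → V →ₗ[K] V) (B : α → W →ₗ[K] W)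
    (hAB : ∀ a x, B a (T x) = S (A a x)) :
    CodeEquivalent {M | ∃ a, M = LinearMap.toMatrix bV bV (A a)}
      {M | ∃ a, M = LinearMap.toMatrix bW bW (B a)} := by
  obtain ⟨bT, hbT⟩ := exists_basis_of_semilinear bV bW τ T hT hTτ
  obtain ⟨bS, hbS⟩ := exists_basis_of_semilinear bV bW τ S hS hSτ
  have key : ∀ a, LinearMap.toMatrix bW bW (B a) = bW.toMatrix bS
      * RingEquiv.mapMatrix τ (LinearMap.toMatrix bV bV (A a)) * bT.toMatrix bW := by
    intro a
    -- From the basis `T(bV)` to the basis `S(bV)`, the matrix of `B a` is that of `A a` with `τ`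
    -- applied entrywise. The transition matrices to `bW` do not depend on `a` and serve as `X` and
    -- `Y`.
    rw [← basis_toMatrix_mul_linearMap_toMatrix_mul_basis_toMatrix bW bT bW bS (B a)]
    congr 2
    ext i j
    rw [LinearMap.toMatrix_apply, hbT, hAB, repr_semilinear bV bS τ S hSτ hbS]
    simp [LinearMap.toMatrix_apply]
  refine ⟨RingEquiv.mapMatrix τ,
    ⟨_, _, bW.toMatrix_mul_toMatrix_flip bS, bS.toMatrix_mul_toMatrix_flip bW⟩,
    ⟨_, _, bT.toMatrix_mul_toMatrix_flip bW, bW.toMatrix_mul_toMatrix_flip bT⟩, ?_⟩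
  ext M
  constructor
  · rintro ⟨a, rfl⟩
    exact ⟨_, ⟨a, rfl⟩, key a⟩
  · rintro ⟨_, ⟨a, rfl⟩, rfl⟩
    exact ⟨a, (key a).symm⟩

/-! ### Automorphisms of the twisted polynomial ring -/

/-- `a σ(a) ⋯ σ^{i-1}(a)`, the coefficient of `(a t)^i`. -/
def partialNorm (σ : K ≃ₐ[F] K) (a : K) (i : ℕ) : K := ∏ j ∈ Finset.range i, (σ ^ j) a

/-- The cocycle identity behind `(at)^(i+j) = (at)^i (at)^j`; it makes the substitution `t ↦ at`
multiplicative. -/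
theorem partialNorm_add (σ : K ≃ₐ[F] K) (a : K) (i j : ℕ) :
    partialNorm σ a (i + j) = partialNorm σ a i * (σ ^ i) (partialNorm σ a j) := by
  simp only [partialNorm, Finset.prod_range_add, map_prod, pow_add, AlgEquiv.mul_apply]

theorem partialNorm_ne_zero (σ : K ≃ₐ[F] K) {a : K} (ha : a ≠ 0) (i : ℕ) :
    partialNorm σ a i ≠ 0 :=
  Finset.prod_ne_zero_iff.2 fun j _ => (map_ne_zero_iff _ (σ ^ j).injective).2 ha

/-- `σ` has order `n = [K : F]`, so its first `n` powers run once through the Galois group and the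
product is the norm. -/
theorem partialNorm_finrank [FiniteDimensional F K] [IsGalois F K] {σ : K ≃ₐ[F] K}
    (hσ : Subgroup.zpowers σ = ⊤) (a : K) :
    partialNorm σ a (Module.finrank F K) = algebraMap F K (Algebra.norm F a) := by
  classical
  have hmem : ∀ x : K ≃ₐ[F] K, x ∈ Subgroup.zpowers σ := fun x => hσ ▸ Subgroup.mem_top x
  have hord : orderOf σ = Module.finrank F K := by
    rw [orderOf_eq_card_of_forall_mem_zpowers hmem, IsGalois.card_aut_eq_finrank]
  rw [Algebra.norm_eq_prod_automorphisms, ← IsCyclic.image_range_orderOf hmem,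
    Finset.prod_image fun i hi j hj h => pow_injOn_Iio_orderOf (by simpa using hi)
      (by simpa using hj) h, hord, partialNorm]

namespace TwistedPoly

variable {σ : K ≃ₐ[F] K}

/-- The ring homomorphism `K[t;σ] → K[t;σ]` with `c ↦ τ(c)` for `c ∈ K` and `t ↦ a t`,
as a function. -/
def substFun (σ : K ≃ₐ[F] K) (τ : RingAut K) (a : K) (p : TwistedPoly σ) : TwistedPoly σ :=
  ∑ i ∈ Finset.range (p.natDegree + 1), const σ (τ (p.coeff i) * partialNorm σ a i) * t σ ^ i

theorem coeff_substFun (τ : RingAut K) (a : K) (p : TwistedPoly σ) (i : ℕ) :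
    (substFun σ τ a p).coeff i = τ (p.coeff i) * partialNorm σ a i := by
  simp only [substFun, coeff_sum, coeff_const_mul_t_pow, Finset.sum_ite_eq', Finset.mem_range]
  split_ifs with h
  · rfl
  · rw [coeff_eq_zero_of_natDegree_lt (by omega), map_zero, zero_mul]

/-- The ring homomorphism `K[t;σ] → K[t;σ]` with `c ↦ τ(c)` for `c ∈ K` and `t ↦ a t`. -/
def subst (τ : RingAut K) (hτ : ∀ c, σ (τ c) = τ (σ c)) (a : K) :
    TwistedPoly σ →+* TwistedPoly σ where
  toFun := substFun σ τ a
  map_zero' := by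
    ext i
    simp [coeff_substFun]
  map_one' := by
    ext i
    rw [coeff_substFun, coeff_one]
    split_ifs with h
    · simp [← h, partialNorm]
    · simp
  map_add' p q := by
    ext i
    simp only [coeff_substFun, coeff_add, map_add, add_mul]
  map_mul' p q := by
    have hτ' : ∀ (j : ℕ) c, (σ ^ j) (τ c) = τ ((σ ^ j) c) := by
      intro j
      induction j with
      | zero => simp
      | succ j ih => intro c; rw [pow_succ, AlgEquiv.mul_apply, AlgEquiv.mul_apply, hτ, ih]
    ext i
    rw [coeff_substFun, coeff_mul, coeff_mul, map_sum, Finset.sum_mul]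
    refine Finset.sum_congr rfl fun x hx => ?_
    rw [← Finset.HasAntidiagonal.mem_antidiagonal.1 hx, partialNorm_add, coeff_substFun,
      coeff_substFun, map_mul,
      map_mul, hτ']
    ring

variable (τ : RingAut K) (hτ : ∀ c, σ (τ c) = τ (σ c)) (a : K)

theorem coeff_subst (p : TwistedPoly σ) (i : ℕ) :
    (subst τ hτ a p).coeff i = τ (p.coeff i) * partialNorm σ a i := coeff_substFun τ a p i

theorem subst_injective {a : K} (ha : a ≠ 0) : Function.Injective (subst τ hτ a) := by
  refine (injective_iff_map_eq_zero _).2 fun p hp => ext fun i => ?_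
  have h := coeff_subst τ hτ a p i
  rw [hp, coeff_zero, eq_comm, mul_eq_zero] at h
  exact (map_eq_zero_iff _ τ.injective).1 (h.resolve_right (partialNorm_ne_zero σ ha i))

theorem subst_mem_degreeLT {m : ℕ} {p : TwistedPoly σ} (hp : p ∈ degreeLT σ m) :
    subst τ hτ a p ∈ degreeLT σ m := fun i hi => by
  rw [coeff_subst, hp i hi, map_zero, zero_mul]

theorem subst_smul (c : K) (p : TwistedPoly σ) :
    subst τ hτ a (c • p) = τ c • subst τ hτ a p := ext fun i => by
  rw [coeff_subst, coeff_smul, coeff_smul, coeff_subst, map_mul, mul_assoc]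

theorem evalTPow_eq_sum (h : F[X]) : evalTPow σ h = ∑ i ∈ Finset.range (h.natDegree + 1),
    const σ (algebraMap F K (h.coeff i)) * t σ ^ (Module.finrank F K * i) := by
  rw [evalTPow, eval₂_eq_sum_range]
  simp only [RingHom.comp_apply, pow_mul]

theorem coeff_evalTPow [FiniteDimensional F K] (h : F[X]) (i : ℕ) :
    (evalTPow σ h).coeff i
      = if Module.finrank F K ∣ i then algebraMap F K (h.coeff (i / Module.finrank F K)) else 0 := by
  have hn : 0 < Module.finrank F K := Module.finrank_pos
  simp only [evalTPow_eq_sum, coeff_sum, coeff_const_mul_t_pow]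
  split_ifs with hd
  · obtain ⟨k, rfl⟩ := hd
    simp only [mul_right_inj' hn.ne', Finset.sum_ite_eq', Finset.mem_range,
      Nat.mul_div_cancel_left k hn]
    split_ifs with hk
    · rfl
    · rw [Polynomial.coeff_eq_zero_of_natDegree_lt (by omega), map_zero]
  · refine Finset.sum_eq_zero fun k _ => if_neg ?_
    rintro rfl
    exact hd (dvd_mul_right _ _)

theorem partialNorm_finrank_mul [FiniteDimensional F K] [IsGalois F K]
    (hσ : Subgroup.zpowers σ = ⊤) (k : ℕ) :
    partialNorm σ a (Module.finrank F K * k) = algebraMap F K (Algebra.norm F a ^ k) := by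
  induction k with
  | zero => simp [partialNorm]
  | succ k ih =>
    rw [Nat.mul_succ, partialNorm_add, ih, partialNorm_finrank hσ, AlgEquiv.commutes, ← map_mul,
      pow_succ]

/-- `t ↦ a t`, `c ↦ τ(c)` maps `h(t^n)` to `λ^{m₀} h^{(λ,τ)}(t^n)`, `λ = N(a)`. -/
theorem subst_evalTPow [FiniteDimensional F K] [IsGalois F K] (hσ : Subgroup.zpowers σ = ⊤)
    (τ : stableAut σ) {a : K} {l : Fˣ} (hl : Algebra.norm F a = l) (m₀ : ℕ) (h : F[X]) :
    subst τ.1 τ.2.1 a (evalTPow σ h) = const σ (algebraMap F K ((l : F) ^ m₀))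
      * evalTPow σ (twist m₀ l (stableAut.restrict σ τ) h) := by
  ext i
  rw [coeff_subst, coeff_const_mul, coeff_evalTPow, coeff_evalTPow]
  split_ifs with hd
  · obtain ⟨k, rfl⟩ := hd
    -- The coefficient of `t^(nk)` acquires the factor `N(a)^k = λ^k`; the prefactor `λ^{m₀}`
    -- cancels the normalisation in `twist`.
    rw [Nat.mul_div_cancel_left k Module.finrank_pos, partialNorm_finrank_mul a hσ, hl, coeff_twist,
      ← map_mul, ← mul_assoc, ← mul_pow, mul_inv_cancel₀ l.ne_zero, one_pow, one_mul, map_mul,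
      stableAut.algebraMap_restrict]
  · rw [map_zero, zero_mul, mul_zero]

end TwistedPoly

/-! ### Equivalence of the codes of two Petit algebras -/

namespace PetitAlgebra

variable {σ : K ≃ₐ[F] K} {f : TwistedPoly σ}

/-- The annihilator of `R/Rf` is contained in `R f^*`, and it suffices to test annihilation on
finitely many elements, as `F` is central. -/
theorem mem_span_bound_of_forall_mul_mem [FiniteDimensional F K] (hf : f ≠ 0) {b : TwistedPoly σ}
    (hb : f.IsBound b) {m : ℕ} (bf : Module.Basis (Fin m) K (PetitAlgebra f)) (x : TwistedPoly σ)
    (hx : ∀ i : Fin (Module.finrank F K) × Fin m,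
      x * (Module.finBasis F K i.1 • toPoly (bf i.2)) ∈ Ideal.span {f}) :
    x ∈ Ideal.span {b} := by
  have hlt : ∀ v : PetitAlgebra f, x * toPoly v ∈ Ideal.span {f} := by
    intro v
    rw [← bf.sum_repr v, map_sum, Finset.mul_sum]
    refine sum_mem fun j _ => ?_
    rw [map_smul, ← (Module.finBasis F K).sum_repr (bf.repr v j), Finset.sum_smul, Finset.mul_sum]
    refine sum_mem fun k _ => ?_
    rw [Algebra.smul_def, mul_smul, smul_eq (algebraMap F K _), ← mul_assoc,
      ← const_algebraMap_mul_comm, mul_assoc]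
    exact Ideal.mul_mem_left _ _ (hx (k, j))
  have hall : ∀ v : TwistedPoly σ, x * v ∈ Ideal.span {f} := by
    intro v
    have h1 := add_mem (Ideal.mul_mem_left _ x (sub_modr_mem hf v)) (hlt (ofPoly f v))
    rwa [toPoly_ofPoly, ← mul_add, sub_add_cancel] at h1
  -- The annihilator of `R/Rf` is two-sided and, by `v = 1`, lies in `Rf`; so it lies in the largest
  -- such ideal, `R b`.
  let A : Ideal (TwistedPoly σ) :=
    { carrier := {y | ∀ v, y * v ∈ Ideal.span {f}}
      add_mem' := fun hy hz v => by
        rw [add_mul]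
        exact add_mem (hy v) (hz v)
      zero_mem' := fun v => by
        rw [zero_mul]
        exact zero_mem _
      smul_mem' := fun c y hy v => by
        rw [smul_eq_mul, mul_assoc]
        exact Ideal.mul_mem_left _ _ (hy v) }
  have hA : A.IsTwoSided := ⟨fun {y} c hy v => by
    rw [mul_assoc]
    exact hy (c * v)⟩
  exact hb.2.2 (show A ∈ _ from ⟨hA, fun y hy => by simpa using hy 1⟩) hall

variable {g : TwistedPoly σ}

/-- If `t ↦ a t`, `c ↦ τ(c)` maps a bound of `f` into `R g`, where `f` and `g` are irreducible of
the same degree, then the codes of `S_f` and `S_g` are equivalent. -/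
theorem codeEquivalent_code [FiniteDimensional F K] (hf : Irreducible f) (hg : Irreducible g)
    {m : ℕ} (hfm : f.natDegree = m) (hgm : g.natDegree = m) {b : TwistedPoly σ} (hb : f.IsBound b)
    (τ : RingAut K) (hτ : ∀ c, σ (τ c) = τ (σ c)) {a : K} (ha : a ≠ 0)
    (hbg : subst τ hτ a b ∈ Ideal.span {g}) (bf : Module.Basis (Fin m) K (PetitAlgebra f))
    (bg : Module.Basis (Fin m) K (PetitAlgebra g)) : CodeEquivalent (code bf) (code bg) := by
  have hf0 := hf.ne_zero
  have hg0 := hg.ne_zero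
  set Ψ := subst τ hτ a with hΨ
  set J : Ideal (TwistedPoly σ) := Ideal.comap Ψ (Ideal.span {g}) with hJ
  have hJ1 : (1 : TwistedPoly σ) ∉ J := fun h =>
    one_notMem_span hg (by simpa only [hJ, Ideal.mem_comap, map_one] using h)
  have hmax := isMaximal_span_of_irreducible hf
  obtain ⟨u, huJ, hu⟩ := exists_notMem_forall_mul_mem hmax hJ1
    (fun i : Fin (Module.finrank F K) × Fin m => Module.finBasis F K i.1 • toPoly (bf i.2))
    Finset.univ fun x hx => (Ideal.span_singleton_le_iff_mem J).2 hbg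
      (mem_span_bound_of_forall_mul_mem hf0 hb bf x fun i => hx i (Finset.mem_univ i))
  -- `R/Rf` is simple, so the nonzero map `x ↦ x * u` to `R/J` is injective.
  have hker : ∀ x, x * u ∈ J → x ∈ Ideal.span {f} := by
    intro x hx
    by_contra hxf
    have htop : Ideal.span {f} ⊔ Ideal.span {x} = ⊤ := hmax.out.2 _ <|
      lt_of_le_of_ne le_sup_left fun he =>
        hxf (he ▸ Ideal.mem_sup_right (Ideal.mem_span_singleton_self _))
    obtain ⟨p, hp, z, hz, hsum⟩ := Submodule.mem_sup.1 ((Ideal.eq_top_iff_one _).1 htop)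
    obtain ⟨c, rfl⟩ := Ideal.mem_span_singleton'.1 hz
    apply huJ
    rw [← one_mul u, ← hsum, add_mul, mul_assoc]
    exact add_mem (hu p hp) (Ideal.mul_mem_left _ _ hx)
  let T : PetitAlgebra f →+ PetitAlgebra g :=
    AddMonoidHom.mk' (fun x => ofPoly g (Ψ (toPoly x))) fun x y => by
      rw [map_add, map_add, ofPoly_add]
  let S : PetitAlgebra f →+ PetitAlgebra g :=
    AddMonoidHom.mk' (fun x => ofPoly g (Ψ (toPoly x * u))) fun x y => by
      rw [map_add, add_mul, map_add, ofPoly_add]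
  -- `Ψ` does not raise degrees and `deg f = deg g`, so no reduction modulo `g` takes place.
  have hTpoly : ∀ x, toPoly (T x) = Ψ (toPoly x) := fun x =>
    modr_eq (q := 0) hg0 (hgm ▸ hfm ▸ subst_mem_degreeLT τ hτ a (toPoly_mem x)) (by simp)
  have hSpoly : ∀ x, toPoly (S x) = modr g (Ψ (toPoly x * u)) := fun _ => rfl
  have hTτ : ∀ (c : K) x, T (c • x) = τ c • T x := fun c x => toPoly_injective <| by
    rw [hTpoly, map_smul, hΨ, subst_smul, map_smul, hTpoly]
  have hSτ : ∀ (c : K) x, S (c • x) = τ c • S x := fun c x => toPoly_injective <| by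
    rw [hSpoly, map_smul, map_smul, hSpoly, smul_eq, mul_assoc, ← smul_eq, hΨ, subst_smul, modr_smul]
  have hT : ∀ x, T x = 0 → x = 0 := fun x hx => toPoly_injective <| subst_injective τ hτ ha <| by
    rw [← hΨ, ← hTpoly, hx]
    simp
  have hS : ∀ x, S x = 0 → x = 0 := fun x hx => toPoly_injective <| by
    rw [map_zero]
    refine eq_zero_of_mem_span hf0 (toPoly_mem x) (hker _ ?_)
    rw [hJ, Ideal.mem_comap, ← modr_eq_zero_iff hg0, ← hSpoly, hx, map_zero]
  have hST : ∀ c x, rightMul (S c) (T x) = S (rightMul c x) := fun c x => toPoly_injective <| by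
    change toPoly (T x * S c) = toPoly (S (x * c))
    rw [toPoly_mul, hTpoly, hSpoly, hSpoly, toPoly_mul]
    refine modr_congr hg0 ?_
    -- Both sides are `Ψ(x c u)` modulo `Rg`: reducing `Ψ(c u)` modulo `g` is harmless under left
    -- multiplication, and reducing `x c` modulo `f` is harmless because `(Rf)u ⊆ J`.
    have h1 := Ideal.mul_mem_left _ (Ψ (toPoly x)) (sub_modr_mem hg0 (Ψ (toPoly c * u)))
    have h2 := hu _ (sub_modr_mem hf0 (toPoly x * toPoly c))
    rw [hJ, Ideal.mem_comap, sub_mul, map_sub] at h2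
    have h3 := sub_mem h2 h1
    rwa [mul_sub, ← Ψ.map_mul, ← mul_assoc, sub_sub_sub_cancel_left] at h3
  -- Surjectivity of `S` lets all of `C'` be indexed by `S_f`.
  have hcode : code bg = {M | ∃ c, M = LinearMap.toMatrix bg bg (rightMul (S c))} := by
    ext M
    exact (surjective_of_semilinear bf bg τ S hS hSτ).exists
  rw [hcode]
  exact codeEquivalent_of_semilinear bf bg τ T S hT hTτ hS hSτ rightMul _ hST

end PetitAlgebra

end PetitCode

end

theorem mainTheorem5 {F K : Type*} [Field F] [Field K] [Algebra F K]
    [FiniteDimensional F K] [IsGalois F K]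
    (σ : K ≃ₐ[F] K) (hσ : Subgroup.zpowers σ = ⊤)
    (m m₀ : ℕ) (h₁ h₂ : PetitCode.MonicIrreducible F m₀)
    (horbit : h₂ ∈ MulAction.orbit (PetitCode.OrbitGroup σ) h₁)
    (f g : PetitCode.TwistedPoly σ)
    (hfmonic : f.Monic) (hgmonic : g.Monic)
    (hfirr : Irreducible f) (hgirr : Irreducible g)
    (hfdeg : f.natDegree = m) (hgdeg : g.natDegree = m)
    (hfbound : f.IsBound (PetitCode.TwistedPoly.evalTPow σ h₁.1))
    (hgbound : g.IsBound (PetitCode.TwistedPoly.evalTPow σ h₂.1))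
    (bf : Module.Basis (Fin m) K (PetitCode.PetitAlgebra f))
    (bg : Module.Basis (Fin m) K (PetitCode.PetitAlgebra g)) :
    PetitCode.IsLinearMRD F (PetitCode.PetitAlgebra.code bf) ∧
      PetitCode.IsLinearMRD F (PetitCode.PetitAlgebra.code bg) ∧
      PetitCode.CodeEquivalent (PetitCode.PetitAlgebra.code bf)
        (PetitCode.PetitAlgebra.code bg) := by
  have hm : 0 < m := hfdeg ▸ PetitCode.TwistedPoly.natDegree_pos_of_irreducible hfirr
  refine ⟨PetitCode.PetitAlgebra.isLinearMRD_code hfirr hm bf,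
    PetitCode.PetitAlgebra.isLinearMRD_code hgirr hm bg, ?_⟩
  obtain ⟨γ, rfl⟩ := horbit
  -- Since `λ` is a norm, some `a` has `N(a) = λ`; it defines the substitution `t ↦ at`.
  obtain ⟨a, ha⟩ := γ.left.2
  refine PetitCode.PetitAlgebra.codeEquivalent_code hfirr hgirr hfdeg hgdeg hfbound γ.right.1
    γ.right.2.1 a.ne_zero ?_ bf bg
  rw [PetitCode.TwistedPoly.subst_evalTPow hσ γ.right (congrArg Units.val ha) m₀ h₁.1]
  exact Ideal.mul_mem_left _ _ (hgbound.2.1.2 (Ideal.mem_span_singleton_self _))
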